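/- Let $k\ge 2$, $n_1,\dots,n_k\ge 1$, $n_s\ge 1$ be integers, $N_k=\sum_{i=1}^k n_i$, and let $\theta_0\in\mathbb R$, $\sigma_0>0$, $\sigma>0$. Let $\theta\sim N(\theta_0,\sigma_0^2)$ and, given $\theta$, let $N_k+n_s+1$ real data points be i.i.d. $N(\theta,\sigma^2)$: for each $i$ a private sample $\boldsymbol x_i$ of $n_i$ points, a sample $\boldsymbol x_s$ of $n_s$ points shared by all experts, and one further point $x$. Let $y=1$ if $x>0$ and $y=0$ otherwise. Put $p_0=P(y=1)$, let expert $i$ report $p_i=P(y=1\mid \boldsymbol x_i,\boldsymbol x_s)$ $(i=1,\dots,k)$, and let $t_s$ be the sum of the data points in $\boldsymbol x_s$. Let $\Phi$ be the standard normal distribution function, and for integers $n\ge 0$ let $v_n=(\sigma^2/\sigma_0^2+n)(\sigma^2/\sigma_0^2+n+1)\sigma^2$. Then $p_0\in(0,1)$, almost surely all $p_i\in(0,1)$, $t_s$ is square integrable, and the Bayesian ensemble $\hat p=P(y=1\mid p_1,\dots,p_k)$ satisfies, almost surely, $$\hat p=\Phi\left(\frac{-(k-1)\sqrt{v_0}\,\Phi^{-1}(p_0)+\sum_{i=1}^k\sqrt{v_{n_i+n_s}}\,\Phi^{-1}(p_i)-(k-1)E[t_s\mid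 p_1,\dots,p_k]}{\sqrt{(k-1)^2\,\mathrm{Var}[t_s\mid p_1,\dots,p_k]+v_{N_k+n_s}}}\right).$$ Moreover, let $\tau_1=\sigma^2\theta_0/\sigma_0^2$, $m_s=n_s\theta_0$, $m_i=(n_i+n_s)\theta_0$, $V_{11}=n_s\sigma^2+n_s^2\sigma_0^2$, let $V_{12}=V_{21}'$ be the row vector with entries $n_s\sigma^2+(n_sn_j+n_s^2)\sigma_0^2$, and let $V_{22}$ be the $k\times k$ matrix with diagonal entries $(n_i+n_s)\sigma^2+(n_i+n_s)^2\sigma_0^2$ and off-diagonal entries $n_s\sigma^2+(n_in_j+n_in_s+n_sn_j+n_s^2)\sigma_0^2$. Then $V_{22}$ is invertible and, almost surely, $$E[t_s\mid p_1,\dots,p_k]=m_s+V_{12}V_{22}^{-1}\left(\sqrt{v_{n_i+n_s}}\,\Phi^{-1}(p_i)-\tau_1-m_i\right)_{i=1}^k,\qquad \mathrm{Var}[t_s\mid p_1,\dots,p_k]=V_{11}-V_{12}V_{22}^{-1}V_{21}.$$ In particular, the conditional mean is linear (with a constant term) in $(\Phi^{-1}(p_1),\dots,\Phi^{-1}(p_k))$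 and the conditional variance does not depend on $(p_1,\dots,p_k)$. -/

import Mathlib

open MeasureTheory ProbabilityTheory
open scoped NNReal ENNReal Matrix

namespace NormalEnsemble

noncomputable section

/-- `Φ`, the cumulative distribution function of the standard normal distribution. -/
def stdNormalCDF (x : ℝ) : ℝ := cdf (gaussianReal 0 1) x

/-- `Φ⁻¹`, the inverse of the injective function `Φ : ℝ → ℝ`, whose range is the open interval
`(0, 1)`; its values off that interval are immaterial. -/
def probit : ℝ → ℝ := Function.invFun stdNormalCDF

/-- Labels of the data points: `n i` points in the private sample of expert `i`, `ns` points in the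
sample shared by the experts, and one further point that decides the binary event. -/
abbrev SampleIndex (k : ℕ) (n : Fin k → ℕ) (ns : ℕ) : Type :=
  (Σ i : Fin k, Fin (n i)) ⊕ (Fin ns ⊕ Unit)

/-- The likelihood: given `t`, the data points are i.i.d. normal with mean `t` and variance `σ²`. -/
def iidNormalKernel (ι : Type) [Fintype ι] (σ : ℝ) : Kernel ℝ (ι → ℝ) where
  toFun t := Measure.pi fun _ : ι => gaussianReal t (Real.toNNReal (σ ^ 2))
  measurable' := by
    refine Measurable.measure_of_isPiSystem_of_isProbabilityMeasure
      generateFrom_pi.symm isPiSystem_pi ?_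
    rintro s ⟨u, hu, rfl⟩
    simp only [Measure.pi_pi]
    refine Finset.measurable_prod _ fun i _ => ?_
    have h : Measurable fun t : ℝ => gaussianReal t (Real.toNNReal (σ ^ 2)) :=
      measurable_gaussianReal.comp (measurable_id.prodMk measurable_const)
    exact (Measure.measurable_coe (show MeasurableSet (u i) from hu i (Set.mem_univ i))).comp h

instance (ι : Type) [Fintype ι] (σ : ℝ) : IsMarkovKernel (iidNormalKernel ι σ) :=
  ⟨fun t => by
    unfold iidNormalKernel
    change IsProbabilityMeasure (Measure.pi _)
    infer_instance⟩

variable {Ω : Type*} [MeasurableSpace Ω]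

/-- The normal/normal conjugate pair: the mean `θ` is normal with mean `θ₀` and variance `σ₀²`, and,
given `θ`, the data points `X j` are i.i.d. normal with mean `θ` and variance `σ²`. -/
structure IsNormalNormalPair {ι : Type} [Fintype ι] (μ : Measure Ω) (θ₀ σ₀ σ : ℝ)
    (θ : Ω → ℝ) (X : ι → Ω → ℝ) : Prop where
  measurable_mean : Measurable θ
  measurable_data : ∀ j, Measurable (X j)
  law : μ.map (fun ω => (θ ω, fun j => X j ω)) =
    (gaussianReal θ₀ (Real.toNNReal (σ₀ ^ 2))) ⊗ₘ (iidNormalKernel ι σ)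

variable {k : ℕ} {n : Fin k → ℕ} {ns : ℕ}

/-- The event `y = 1`: the last data point lies in `A = (0, ∞)`. -/
def event (X : SampleIndex k n ns → Ω → ℝ) : Set Ω :=
  {ω | X (Sum.inr (Sum.inr ())) ω ∈ Set.Ioi (0 : ℝ)}

/-- The sigma-algebra generated by what expert `i` sees: her private sample and the shared one. -/
abbrev expertInfo (X : SampleIndex k n ns → Ω → ℝ) (i : Fin k) : MeasurableSpace Ω :=
  MeasurableSpace.comap
    (fun ω => ((fun j : Fin (n i) => X (Sum.inl ⟨i, j⟩) ω),
      (fun j : Fin ns => X (Sum.inr (Sum.inl j)) ω))) inferInstance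

/-- `q` is a version of the conditional probability of the event `E` given the sigma-algebra `m`. -/
def IsCondProb (μ : Measure Ω) (m : MeasurableSpace Ω) (E : Set Ω) (q : Ω → ℝ) : Prop :=
  Measurable[m] q ∧ q =ᵐ[μ] μ⟦E | m⟧

/-- The sigma-algebra generated by the experts' reports `(p_1, …, p_k)`. -/
abbrev reportInfo (p : Fin k → Ω → ℝ) : MeasurableSpace Ω :=
  MeasurableSpace.comap (fun ω i => p i ω) inferInstance

/-- The sufficient statistic `t_s` of the shared sample: the sum of its data points. -/
def sharedStat (X : SampleIndex k n ns → Ω → ℝ) (ω : Ω) : ℝ :=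
  ∑ j : Fin ns, X (Sum.inr (Sum.inl j)) ω

/-- `v_N = (σ²/σ₀² + N)(σ²/σ₀² + N + 1)σ²`. -/
def predVar (σ₀ σ : ℝ) (N : ℕ) : ℝ :=
  (σ ^ 2 / σ₀ ^ 2 + N) * (σ ^ 2 / σ₀ ^ 2 + N + 1) * σ ^ 2

/-- The prior hyperparameter `τ₁ = σ²θ₀/σ₀²`. -/
def priorTau (θ₀ σ₀ σ : ℝ) : ℝ := σ ^ 2 * θ₀ / σ₀ ^ 2

/-- The variance `V₁₁` of `t_s`. -/
def covSS (σ₀ σ : ℝ) (ns : ℕ) : ℝ := ns * σ ^ 2 + ns ^ 2 * σ₀ ^ 2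

/-- The vector `V₁₂` of the covariances of `t_s` with `t_j + t_s`. -/
def covST (σ₀ σ : ℝ) (n : Fin k → ℕ) (ns : ℕ) : Fin k → ℝ := fun j =>
  ns * σ ^ 2 + (ns * n j + ns ^ 2) * σ₀ ^ 2

/-- The covariance matrix `V₂₂` of `(t_1 + t_s, …, t_k + t_s)`. -/
def covTT (σ₀ σ : ℝ) (n : Fin k → ℕ) (ns : ℕ) : Matrix (Fin k) (Fin k) ℝ :=
  Matrix.of fun i j =>
    if i = j then (n i + ns) * σ ^ 2 + (n i + ns) ^ 2 * σ₀ ^ 2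
    else ns * σ ^ 2 + (n i * n j + n i * ns + ns * n j + ns ^ 2) * σ₀ ^ 2

/-- The conditional mean of `t_s` given the reports, as a function of `(Φ⁻¹(p_1), …, Φ⁻¹(p_k))`:
`m_s + V₁₂ V₂₂⁻¹ (√v_{n_i + n_s} Φ⁻¹(p_i) - τ₁ - m_i)_i` with `m_s = n_s θ₀` and
`m_i = (n_i + n_s) θ₀`. -/
def sharedMean (θ₀ σ₀ σ : ℝ) (n : Fin k → ℕ) (ns : ℕ) (u : Fin k → ℝ) : ℝ :=
  ns * θ₀ + covST σ₀ σ n ns ⬝ᵥ ((covTT σ₀ σ n ns)⁻¹ *ᵥ fun i =>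
    √(predVar σ₀ σ (n i + ns)) * u i - priorTau θ₀ σ₀ σ - (n i + ns) * θ₀)

/-- The conditional variance of `t_s` given the reports, `V₁₁ - V₁₂ V₂₂⁻¹ V₂₁`. -/
def sharedVar (σ₀ σ : ℝ) (n : Fin k → ℕ) (ns : ℕ) : ℝ :=
  covSS σ₀ σ ns - covST σ₀ σ n ns ⬝ᵥ ((covTT σ₀ σ n ns)⁻¹ *ᵥ covST σ₀ σ n ns)

end

end NormalEnsemble

/-! The data are jointly normal with covariances `σ₀² + δ_ij σ²`, so every quantity is a linear
statistic, covariances are given by the bilinear form `linCov`, and uncorrelated statistics are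
independent (`indepFun_linStat`).

Put `κ = σ²/σ₀²` and let `s` be the sum of `N` observed points. The error `e = (κ + N) x - s` is
uncorrelated with those points and has mean `τ₁` and variance `v_N`. Hence `x > 0` means that the
signal `τ₁ + s` plus independent centred normal noise is positive, which has conditional probability
`Φ((τ₁ + s)/√v_N)` (`condExp_indicator_pos`, `condExp_event`). With `N = 0` this gives `√v₀ Φ⁻¹(p₀)
= τ₁`; for expert `i` it gives `√v Φ⁻¹(p_i) = τ₁ + T_i` with `T_i = t_i + t_s`, so the reports
amount to the sums `T_i`.

The pooled sum is `∑ T_i - (k-1) t_s`. Regression on the `T_i` splits `t_s` into a function of the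
reports and a residual `D` independent of them; this gives the conditional mean and variance. For
the ensemble, the noise in `(κ + N) x` is then `e - (k-1) D`. Its two terms are uncorrelated, so its
variance is `v_N + (k-1)² Var D`, and the signal-plus-noise lemma applies again
(`condExp_event_reportInfo`). -/

namespace NormalEnsemble

/-! ### The standard normal distribution function and its inverse. -/

lemma stdNormalCDF_eq_real (x : ℝ) : stdNormalCDF x = (gaussianReal 0 1).real (Set.Iic x) :=
  cdf_eq_real _ x

/-- The jump of a distribution function at a point is the mass of that point, and the normal law has
no atoms. -/
lemma continuous_stdNormalCDF : Continuous stdNormalCDF := by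
  rw [continuous_iff_continuousAt]
  intro x
  have h : Monotone stdNormalCDF := monotone_cdf (gaussianReal 0 1)
  have hn : (cdf (gaussianReal 0 1)).measure {x} = 0 := by
    rw [measure_cdf]
    have := nullSingletonClass_gaussianReal (μ := 0) (v := 1) one_ne_zero
    exact measure_singleton x
  have h0 := (cdf (gaussianReal 0 1)).measure_singleton x
  rw [hn, eq_comm, ENNReal.ofReal_eq_zero, sub_nonpos] at h0
  rw [h.continuousAt_iff_leftLim_eq_rightLim]
  have hr : Function.rightLim stdNormalCDF x = stdNormalCDF x :=
    (cdf (gaussianReal 0 1)).rightLim_eq x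
  rw [hr]
  exact le_antisymm (h.leftLim_le le_rfl) h0

/-- Lebesgue measure is absolutely continuous with respect to the normal law, so nondegenerate
intervals have positive mass. -/
lemma strictMono_stdNormalCDF : StrictMono stdNormalCDF := by
  intro x y hxy
  have hpos : 0 < (gaussianReal 0 1) (Set.Ioc x y) := by
    rw [pos_iff_ne_zero]
    intro h0
    have := (gaussianReal_absolutelyContinuous' 0 (v := 1) one_ne_zero) h0
    rw [Real.volume_Ioc, ENNReal.ofReal_eq_zero] at this
    linarith
  rw [← measure_cdf (gaussianReal 0 1), StieltjesFunction.measure_Ioc, ENNReal.ofReal_pos] at hpos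
  exact sub_pos.1 hpos

lemma stdNormalCDF_mem_Ioo (x : ℝ) : stdNormalCDF x ∈ Set.Ioo (0 : ℝ) 1 :=
  ⟨(cdf_nonneg _ (x - 1)).trans_lt (strictMono_stdNormalCDF (sub_one_lt x)),
    (strictMono_stdNormalCDF (lt_add_one x)).trans_le (cdf_le_one _ (x + 1))⟩

lemma exists_stdNormalCDF_eq {y : ℝ} (hy : y ∈ Set.Ioo (0 : ℝ) 1) : ∃ x, stdNormalCDF x = y :=
  mem_range_of_exists_le_of_exists_ge continuous_stdNormalCDF
    (((tendsto_cdf_atBot (gaussianReal 0 1)).eventually_le_const hy.1).exists)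
    (((tendsto_cdf_atTop (gaussianReal 0 1)).eventually_const_le hy.2).exists)

lemma stdNormalCDF_probit {y : ℝ} (hy : y ∈ Set.Ioo (0 : ℝ) 1) : stdNormalCDF (probit y) = y :=
  Function.invFun_eq (exists_stdNormalCDF_eq hy)

lemma probit_stdNormalCDF (x : ℝ) : probit (stdNormalCDF x) = x :=
  Function.leftInverse_invFun strictMono_stdNormalCDF.injective x

/-- A continuous injection of `ℝ` is a measurable embedding, so its inverse is measurable on the
range; off the range `Function.invFun` is constant. -/
lemma measurable_probit : Measurable probit := by
  have he : MeasurableEmbedding stdNormalCDF :=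
    continuous_stdNormalCDF.measurableEmbedding strictMono_stdNormalCDF.injective
  obtain ⟨g, hg, hgf⟩ := he.exists_measurable_extend measurable_id fun _ => ⟨0⟩
  classical
  have hp : probit = (Set.range stdNormalCDF).piecewise g
      (fun _ => Classical.choice (inferInstance : Nonempty ℝ)) := by
    funext y
    by_cases hy : y ∈ Set.range stdNormalCDF
    · obtain ⟨x, rfl⟩ := hy
      rw [probit_stdNormalCDF, Set.piecewise_eq_of_mem _ _ _ (Set.mem_range_self x)]
      exact (congrFun hgf x).symm
    · rw [Set.piecewise_eq_of_notMem _ _ _ hy]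
      exact Function.invFun_neg hy
  rw [hp]
  exact hg.piecewise he.measurableSet_range measurable_const

/-! ### Signal plus independent normal noise. -/

/-- A centred normal variable exceeds `-x` with probability `Φ(x / √v)`. -/
lemma gaussianReal_real_Ioi_neg {v : ℝ} (hv : 0 < v) (x : ℝ) :
    (gaussianReal 0 v.toNNReal).real (Set.Ioi (-x)) = stdNormalCDF (x / √v) := by
  have hs : 0 < √v := Real.sqrt_pos.2 hv
  -- The minus sign turns the upper tail beyond `-x` into the lower tail below `x / √v`.
  have hmap : (gaussianReal 0 1).map (fun z => -√v * z) = gaussianReal 0 v.toNNReal := by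
    rw [gaussianReal_map_const_mul]
    congr 1
    · simp
    · ext
      simp [Real.sq_sqrt hv.le, hv.le]
  have := nullSingletonClass_gaussianReal (μ := 0) (v := 1) one_ne_zero
  rw [← hmap, map_measureReal_apply (by fun_prop) measurableSet_Ioi, stdNormalCDF_eq_real,
    ← measureReal_congr (Iio_ae_eq_Iic (μ := gaussianReal 0 1) (a := x / √v))]
  congr 1
  ext z
  simp only [Set.mem_preimage, Set.mem_Ioi, Set.mem_Iio, lt_div_iff₀ hs]
  constructor <;> intro h <;> linarith

/-- Conditional probability that a signal with independent centred normal noise is positive. -/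
lemma condExp_indicator_pos {Ω : Type*} {m m₀ : MeasurableSpace Ω} {μ : Measure Ω}
    [IsProbabilityMeasure μ] (hm : m ≤ m₀) {M R : Ω → ℝ} {v : ℝ} (hv : 0 < v)
    (hM : Measurable[m] M) (hR : Measurable R) (hlaw : μ.map R = gaussianReal 0 v.toNNReal)
    (hind : Indep (MeasurableSpace.comap R inferInstance) m μ) {E : Set Ω} (hE : MeasurableSet E)
    (hEMR : E =ᵐ[μ] {ω | 0 < M ω + R ω}) :
    μ⟦E | m⟧ =ᵐ[μ] fun ω => stdNormalCDF (M ω / √v) := by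
  have hf : Measurable[m] fun ω => stdNormalCDF (M ω / √v) :=
    continuous_stdNormalCDF.measurable.comp (hM.div_const _)
  have hint : Integrable (fun ω => stdNormalCDF (M ω / √v)) μ := by
    refine Integrable.of_bound (hf.mono hm le_rfl).aestronglyMeasurable 1 (.of_forall fun ω => ?_)
    rw [Real.norm_eq_abs, abs_of_nonneg (stdNormalCDF_mem_Ioo _).1.le]
    exact (stdNormalCDF_mem_Ioo _).2.le
  refine (ae_eq_condExp_of_forall_setIntegral_eq hm
    ((integrable_const (1 : ℝ)).indicator hE) (fun s _ _ => hint.integrableOn) ?_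
    hf.aestronglyMeasurable).symm
  intro s hs _
  have hs0 := hm s hs
  rw [integral_indicator hE, setIntegral_const, smul_eq_mul, mul_one,
    measureReal_restrict_apply hE]
  -- Pairing `M` with the indicator of `s` lets one product law express both membership in `s` and
  -- the sign of `M + R`.
  have hW : Measurable[m] fun ω => (M ω, s.indicator (1 : Ω → ℝ) ω) :=
    hM.prodMk ((measurable_const (a := (1 : ℝ))).indicator hs)
  have hWR : IndepFun (fun ω => (M ω, s.indicator (1 : Ω → ℝ) ω)) R μ :=
    (indep_of_indep_of_le_right hind hW.comap_le).symm
  have hW0 := hW.mono hm le_rfl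
  have hprod := (indepFun_iff_map_prod_eq_prod_map_map hW0.aemeasurable hR.aemeasurable).1 hWR
  set A : Set ((ℝ × ℝ) × ℝ) := {q | q.1.2 = 1 ∧ 0 < q.1.1 + q.2} with hA
  have hAm : MeasurableSet A :=
    (measurableSet_eq_fun (measurable_snd.comp measurable_fst) measurable_const).inter
      (measurableSet_lt measurable_const ((measurable_fst.comp measurable_fst).add measurable_snd))
  have h1 : (μ.map fun ω => ((M ω, s.indicator (1 : Ω → ℝ) ω), R ω)) A = μ (E ∩ s) := by
    rw [Measure.map_apply (hW0.prodMk hR) hAm]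
    refine measure_congr ?_
    filter_upwards [hEMR] with ω hω
    have hω' : ω ∈ E ↔ 0 < M ω + R ω := iff_of_eq hω
    refine propext ?_
    change (s.indicator (1 : Ω → ℝ) ω = 1 ∧ 0 < M ω + R ω) ↔ (ω ∈ E ∧ ω ∈ s)
    rw [hω', and_comm]
    by_cases h : ω ∈ s <;> simp [h]
  have h2 : (μ.map fun ω => ((M ω, s.indicator (1 : Ω → ℝ) ω), R ω)) A
      = ∫⁻ ω in s, ENNReal.ofReal (stdNormalCDF (M ω / √v)) ∂μ := by
    -- Integrating out the noise first, the inner measure is a normal tail on `s` and zero off `s`.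
    rw [hprod, Measure.prod_apply hAm, lintegral_map (measurable_measure_prodMk_left hAm) hW0,
      ← lintegral_indicator hs0]
    refine lintegral_congr fun ω => ?_
    by_cases h : ω ∈ s
    · simp only [Set.indicator_of_mem h]
      rw [← gaussianReal_real_Ioi_neg hv, hlaw, ofReal_measureReal]
      congr 1
      ext r
      simp [hA, neg_lt_iff_pos_add']
    · simp [hA, h]
  rw [integral_eq_lintegral_of_nonneg_ae (.of_forall fun ω => (stdNormalCDF_mem_Ioo _).1.le)
    (hf.mono hm le_rfl).aestronglyMeasurable, ← h2, h1]
  rfl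

/-! ### Linear statistics and their covariance form. -/

section

variable {Ω : Type*} {ι : Type} [Fintype ι] {σ₀ σ : ℝ}

/-- The linear statistic `∑ j, a j * X j`. -/
def linStat (X : ι → Ω → ℝ) (a : ι → ℝ) (ω : Ω) : ℝ := ∑ j, a j * X j ω

/-- The covariance of two linear statistics, as a bilinear form in their coefficients. -/
def linCov (σ₀ σ : ℝ) (a b : ι → ℝ) : ℝ :=
  σ₀ ^ 2 * ((∑ j, a j) * ∑ j, b j) + σ ^ 2 * (a ⬝ᵥ b)

lemma linStat_sub (X : ι → Ω → ℝ) (a b : ι → ℝ) (ω : Ω) :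
    linStat X (a - b) ω = linStat X a ω - linStat X b ω := by
  simp [linStat, sub_mul, Finset.sum_sub_distrib]

lemma linStat_smul (X : ι → Ω → ℝ) (c : ℝ) (a : ι → ℝ) (ω : Ω) :
    linStat X (c • a) ω = c * linStat X a ω := by
  simp [linStat, Finset.mul_sum, mul_assoc]

lemma linStat_sum {κ : Type*} [Fintype κ] (X : ι → Ω → ℝ) (a : κ → ι → ℝ) (ω : Ω) :
    linStat X (∑ l, a l) ω = ∑ l, linStat X (a l) ω := by
  simp only [linStat, Finset.sum_apply, Finset.sum_mul]
  exact Finset.sum_comm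

lemma linCov_comm (a b : ι → ℝ) : linCov σ₀ σ a b = linCov σ₀ σ b a := by
  rw [linCov, linCov, dotProduct_comm, mul_comm (∑ j, a j)]

lemma linCov_sub_left (a b d : ι → ℝ) :
    linCov σ₀ σ (a - b) d = linCov σ₀ σ a d - linCov σ₀ σ b d := by
  simp only [linCov, Pi.sub_apply, Finset.sum_sub_distrib, sub_dotProduct]
  ring

lemma linCov_smul_left (c : ℝ) (a d : ι → ℝ) :
    linCov σ₀ σ (c • a) d = c * linCov σ₀ σ a d := by
  simp only [linCov, Pi.smul_apply, smul_eq_mul, ← Finset.mul_sum, smul_dotProduct]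
  ring

lemma linCov_sum_left {κ : Type*} [Fintype κ] (a : κ → ι → ℝ) (d : ι → ℝ) :
    linCov σ₀ σ (∑ l, a l) d = ∑ l, linCov σ₀ σ (a l) d := by
  have h : ∑ j, (∑ l, a l) j = ∑ l, ∑ j, a l j := by
    simp only [Finset.sum_apply]
    exact Finset.sum_comm
  simp only [linCov, sum_dotProduct, h, Finset.sum_add_distrib, ← Finset.mul_sum, ← Finset.sum_mul]

lemma linCov_sub_right (a b d : ι → ℝ) :
    linCov σ₀ σ d (a - b) = linCov σ₀ σ d a - linCov σ₀ σ d b := by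
  rw [linCov_comm, linCov_sub_left, linCov_comm a, linCov_comm b]

lemma linCov_smul_right (c : ℝ) (a d : ι → ℝ) :
    linCov σ₀ σ d (c • a) = c * linCov σ₀ σ d a := by
  rw [linCov_comm, linCov_smul_left, linCov_comm a]

lemma linCov_sum_right {κ : Type*} [Fintype κ] (a : κ → ι → ℝ) (d : ι → ℝ) :
    linCov σ₀ σ d (∑ l, a l) = ∑ l, linCov σ₀ σ d (a l) := by
  rw [linCov_comm, linCov_sum_left]
  exact Finset.sum_congr rfl fun l _ => linCov_comm _ _

end

/-! ### Joint normality of the data. -/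

section

variable {Ω : Type*} {mΩ : MeasurableSpace Ω} {μ : Measure Ω}
  {ι : Type} [Fintype ι] {θ₀ σ₀ σ : ℝ} {θ : Ω → ℝ} {X : ι → Ω → ℝ}

/-- The law of the centred data does not depend on `t`; this is what makes the errors independent of
`θ`. -/
lemma iidNormalKernel_map_sub (σ t : ℝ) :
    (iidNormalKernel ι σ t).map (fun x j => x j - t) =
      Measure.pi fun _ : ι => gaussianReal 0 (Real.toNNReal (σ ^ 2)) := by
  change (Measure.pi fun _ : ι => gaussianReal t (Real.toNNReal (σ ^ 2))).map _ = _
  have h : (gaussianReal t (Real.toNNReal (σ ^ 2))).map (fun x => x - t) =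
      gaussianReal 0 (Real.toNNReal (σ ^ 2)) := by
    rw [gaussianReal_map_sub_const, sub_self]
  have hsf : ∀ _ : ι, SigmaFinite ((gaussianReal t (Real.toNNReal (σ ^ 2))).map (fun x => x - t)) :=
    fun _ => by rw [h]; infer_instance
  rw [Measure.pi_map_pi (f := fun _ x => x - t) fun _ => by fun_prop]
  simp_rw [h]

/-- The mean and the errors `X j - θ` are independent normal variables. -/
lemma IsNormalNormalPair.map_errors (hX : IsNormalNormalPair μ θ₀ σ₀ σ θ X) :
    μ.map (fun ω => (θ ω, fun j => X j ω - θ ω)) =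
      (gaussianReal θ₀ (Real.toNNReal (σ₀ ^ 2))).prod
        (Measure.pi fun _ : ι => gaussianReal 0 (Real.toNNReal (σ ^ 2))) := by
  have hψ : Measurable fun q : ℝ × (ι → ℝ) => (q.1, fun j => q.2 j - q.1) := by fun_prop
  have hm : Measurable fun ω => (θ ω, fun j => X j ω) :=
    hX.measurable_mean.prodMk (measurable_pi_lambda _ hX.measurable_data)
  have hc : (fun ω => (θ ω, fun j => X j ω - θ ω)) =
      (fun q : ℝ × (ι → ℝ) => (q.1, fun j => q.2 j - q.1)) ∘ fun ω => (θ ω, fun j => X j ω) := rfl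
  rw [hc, ← Measure.map_map hψ hm, hX.law]
  ext s hs
  rw [Measure.map_apply hψ hs, Measure.compProd_apply (hψ hs), Measure.prod_apply hs]
  refine lintegral_congr fun t => ?_
  rw [← iidNormalKernel_map_sub σ t, Measure.map_apply (by fun_prop) (measurable_prodMk_left hs)]
  rfl

/-- Jointly normal data with mean `θ₀`, variance `σ₀² + σ²` and covariances `σ₀²`. -/
structure IsEquicorrelatedNormal [DecidableEq ι] (μ : Measure Ω) (θ₀ σ₀ σ : ℝ)
    (X : ι → Ω → ℝ) : Prop where
  measurable : ∀ j, Measurable (X j)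
  hasGaussianLaw : HasGaussianLaw (fun ω j => X j ω) μ
  integral_eq : ∀ j, μ[X j] = θ₀
  covariance_eq : ∀ i j, cov[X i, X j; μ] = σ₀ ^ 2 + if i = j then σ ^ 2 else 0

/-- The data are a linear image of the independent normal variables `θ` and `X j - θ`; the common
term `θ` contributes `σ₀²` to every covariance. -/
lemma IsNormalNormalPair.isEquicorrelatedNormal [DecidableEq ι] [IsProbabilityMeasure μ]
    (hX : IsNormalNormalPair μ θ₀ σ₀ σ θ X) : IsEquicorrelatedNormal μ θ₀ σ₀ σ X := by
  have hθ := hX.measurable_mean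
  have he : ∀ j, Measurable fun ω => X j ω - θ ω := fun j => (hX.measurable_data j).sub hθ
  have he' : Measurable fun ω j => X j ω - θ ω := measurable_pi_lambda _ he
  have hθlaw : μ.map θ = gaussianReal θ₀ (Real.toNNReal (σ₀ ^ 2)) := by
    have := congrArg Measure.fst hX.map_errors
    rwa [Measure.fst_prod, Measure.fst_map_prodMk he'] at this
  have helaw : μ.map (fun ω j => X j ω - θ ω) =
      Measure.pi fun _ : ι => gaussianReal 0 (Real.toNNReal (σ ^ 2)) := by
    have := congrArg Measure.snd hX.map_errors
    rwa [Measure.snd_prod, Measure.snd_map_prodMk hθ] at this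
  have hejlaw : ∀ j, μ.map (fun ω => X j ω - θ ω) = gaussianReal 0 (Real.toNNReal (σ ^ 2)) := by
    intro j
    have := congrArg (Measure.map (Function.eval j)) helaw
    rw [(measurePreserving_eval _ j).map_eq, Measure.map_map (measurable_pi_apply j) he'] at this
    exact this
  have hind : IndepFun θ (fun ω j => X j ω - θ ω) μ := by
    rw [indepFun_iff_map_prod_eq_prod_map_map hθ.aemeasurable he'.aemeasurable, hθlaw, helaw]
    exact hX.map_errors
  have heind : iIndepFun (fun j ω => X j ω - θ ω) μ := by
    rw [iIndepFun_iff_map_fun_eq_pi_map fun j => (he j).aemeasurable, helaw]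
    simp_rw [hejlaw]
  have hθG : HasGaussianLaw θ μ := ⟨by rw [hθlaw]; infer_instance⟩
  have hejG : ∀ j, HasGaussianLaw (fun ω => X j ω - θ ω) μ :=
    fun j => ⟨by rw [hejlaw]; infer_instance⟩
  have hG : HasGaussianLaw (fun ω => (θ ω, fun j => X j ω - θ ω)) μ :=
    hind.hasGaussianLaw hθG (heind.hasGaussianLaw hejG)
  have hXe : ∀ j, X j = fun ω => θ ω + (X j ω - θ ω) := fun j => by ext ω; ring
  have hθ2 := hθG.memLp_two
  have he2 := fun j => (hejG j).memLp_two
  have hθe : ∀ j, cov[θ, fun ω => X j ω - θ ω; μ] = 0 := fun j =>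
    (hind.comp measurable_id (measurable_pi_apply j)).covariance_eq_zero hθ2 (he2 j)
  have hθmean : μ[θ] = θ₀ := by
    have := integral_map (μ := μ) hθ.aemeasurable (f := fun x : ℝ => x) (by fun_prop)
    rw [hθlaw, integral_id_gaussianReal] at this
    exact this.symm
  have hθvar : cov[θ, θ; μ] = σ₀ ^ 2 := by
    rw [covariance_self hθ.aemeasurable]
    have := variance_map (μ := μ) (X := id) (Y := θ) (by fun_prop) hθ.aemeasurable
    rw [hθlaw, variance_id_gaussianReal] at this
    rw [Function.id_comp] at this
    rw [← this, Real.coe_toNNReal _ (sq_nonneg _)]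
  have hemean : ∀ j, ∫ ω, (X j ω - θ ω) ∂μ = 0 := by
    intro j
    have := integral_map (μ := μ) (he j).aemeasurable (f := fun x : ℝ => x) (by fun_prop)
    rw [hejlaw, integral_id_gaussianReal] at this
    exact this.symm
  have hecov : ∀ i j, cov[fun ω => X i ω - θ ω, fun ω => X j ω - θ ω; μ] =
      if i = j then σ ^ 2 else 0 := by
    intro i j
    split_ifs with hij
    · subst hij
      rw [covariance_self (he i).aemeasurable]
      have := variance_map (μ := μ) (X := id) (Y := fun ω => X i ω - θ ω) (by fun_prop)
        (he i).aemeasurable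
      rw [hejlaw, variance_id_gaussianReal] at this
      rw [Function.id_comp] at this
      rw [← this, Real.coe_toNNReal _ (sq_nonneg _)]
    · exact (heind.indepFun hij).covariance_eq_zero (he2 i) (he2 j)
  refine ⟨hX.measurable_data, ?_, fun j => ?_, fun i j => ?_⟩
  · have := hG.map_fun (ContinuousLinearMap.pi fun j : ι =>
      ContinuousLinearMap.fst ℝ ℝ (ι → ℝ) +
        (ContinuousLinearMap.proj j).comp (ContinuousLinearMap.snd ℝ ℝ (ι → ℝ)))
    refine this.congr (.of_forall fun ω => ?_)
    ext j
    simp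
  · rw [hXe j, integral_add hθG.integrable (hejG j).integrable, hθmean, hemean, add_zero]
  · have h1 : X i = θ + fun ω => X i ω - θ ω := hXe i
    have h2 : X j = θ + fun ω => X j ω - θ ω := hXe j
    rw [h1, h2, covariance_add_left hθ2 (he2 i) (hθ2.add (he2 j)),
      covariance_add_right hθ2 hθ2 (he2 j), covariance_add_right (he2 i) hθ2 (he2 j), hθvar, hθe,
      covariance_comm, hθe, hecov]
    ring

namespace IsEquicorrelatedNormal

variable [DecidableEq ι] (hX : IsEquicorrelatedNormal μ θ₀ σ₀ σ X)
include hX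

lemma measurable_linStat (a : ι → ℝ) : Measurable (linStat X a) :=
  Finset.measurable_sum _ fun j _ => (hX.measurable j).const_mul _

omit [Fintype ι] in
lemma memLp_data (j : ι) : MemLp (X j) 2 μ := (hX.hasGaussianLaw.eval j).memLp_two

lemma hasGaussianLaw_linStat (a : ι → ℝ) : HasGaussianLaw (linStat X a) μ := by
  have := hX.hasGaussianLaw.map_fun
    (∑ j, a j • ContinuousLinearMap.proj (R := ℝ) (φ := fun _ : ι => ℝ) j)
  refine this.congr (.of_forall fun ω => ?_)
  simp [linStat]

lemma integral_linStat [IsProbabilityMeasure μ] (a : ι → ℝ) : μ[linStat X a] = (∑ j, a j) * θ₀ := by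
  change ∫ ω, ∑ j, a j * X j ω ∂μ = _
  rw [integral_finsetSum _ fun j _ => ((hX.memLp_data j).integrable one_le_two).const_mul _,
    Finset.sum_mul]
  refine Finset.sum_congr rfl fun j _ => ?_
  rw [integral_const_mul, hX.integral_eq]

lemma covariance_linStat [IsProbabilityMeasure μ] (a b : ι → ℝ) :
    cov[linStat X a, linStat X b; μ] = linCov σ₀ σ a b := by
  change cov[fun ω => ∑ j, a j * X j ω, fun ω => ∑ j, b j * X j ω; μ] = _
  rw [covariance_fun_sum_fun_sum (X := fun j ω => a j * X j ω) (Y := fun j ω => b j * X j ω)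
    (fun j => (hX.memLp_data j).const_mul _) (fun j => (hX.memLp_data j).const_mul _)]
  simp only [covariance_const_mul_left, covariance_const_mul_right, hX.covariance_eq, mul_add,
    Finset.sum_add_distrib, mul_ite, mul_zero, Finset.sum_ite_eq, Finset.mem_univ, if_true, linCov,
    dotProduct]
  rw [Finset.sum_mul_sum]
  simp only [Finset.mul_sum]
  congr 1
  · exact Finset.sum_congr rfl fun i _ => Finset.sum_congr rfl fun j _ => by ring
  · exact Finset.sum_congr rfl fun i _ => by ring

/-- Uncorrelated linear statistics are independent. -/
lemma indepFun_linStat [IsProbabilityMeasure μ] {κ : Type*} [Finite κ]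
    (r : ι → ℝ) (B : κ → ι → ℝ)
    (h : ∀ l, linCov σ₀ σ r (B l) = 0) :
    IndepFun (linStat X r) (fun ω l => linStat X (B l) ω) μ := by
  have := Fintype.ofFinite κ
  have hG : HasGaussianLaw (fun ω => ((fun _ : Unit => linStat X r ω),
      fun l => linStat X (B l) ω)) μ := by
    have := hX.hasGaussianLaw.map_fun
      ((ContinuousLinearMap.pi fun _ : Unit =>
        ∑ j, r j • ContinuousLinearMap.proj (R := ℝ) (φ := fun _ : ι => ℝ) j).prod
      (ContinuousLinearMap.pi fun l : κ =>
        ∑ j, B l j • ContinuousLinearMap.proj (R := ℝ) (φ := fun _ : ι => ℝ) j))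
    refine this.congr (.of_forall fun ω => ?_)
    ext <;> simp [linStat]
  have hI := hG.indepFun_of_covariance_eval (X := fun _ : Unit => linStat X r)
    (Y := fun l => linStat X (B l)) fun _ l => by rw [hX.covariance_linStat, h]
  exact hI.comp (measurable_pi_apply ()) measurable_id

/-- The law of a centred linear statistic. -/
lemma map_linStat_sub [IsProbabilityMeasure μ] (r : ι → ℝ) {c v : ℝ} (hc : (∑ j, r j) * θ₀ = c)
    (hv : linCov σ₀ σ r r = v) :
    μ.map (fun ω => linStat X r ω - c) = gaussianReal 0 v.toNNReal := by
  have h := (hX.hasGaussianLaw_linStat r).map_eq_gaussianReal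
  rw [hX.integral_linStat, ← covariance_self (hX.measurable_linStat r).aemeasurable,
    hX.covariance_linStat, hc, hv] at h
  have hcomp : (fun ω => linStat X r ω - c) = (fun x => x - c) ∘ linStat X r := rfl
  rw [hcomp, ← Measure.map_map (by fun_prop) (hX.measurable_linStat r), h,
    gaussianReal_map_sub_const, sub_self]

end IsEquicorrelatedNormal

end

/-! ### Coefficient vectors of the statistics and their covariances. -/

section

variable {k : ℕ} (n : Fin k → ℕ) (ns : ℕ)

/-- Coefficients of the sum of the points that expert `i` sees. -/
def expertCoef (i : Fin k) : SampleIndex k n ns → ℝ :=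
  Sum.elim (fun s => if s.1 = i then 1 else 0) (Sum.elim (fun _ => 1) fun _ => 0)

/-- Coefficients of the sum of the shared points. -/
def sharedCoef : SampleIndex k n ns → ℝ :=
  Sum.elim (fun _ => 0) (Sum.elim (fun _ => 1) fun _ => 0)

/-- Coefficients of the sum of all points that some expert sees. -/
def pooledCoef : SampleIndex k n ns → ℝ :=
  Sum.elim (fun _ => 1) (Sum.elim (fun _ => 1) fun _ => 0)

/-- Coefficients of the point that decides the event. -/
def lastCoef : SampleIndex k n ns → ℝ :=
  Sum.elim (fun _ => 0) (Sum.elim (fun _ => 0) fun _ => 1)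

/-- Coefficients of the prediction error `(κ + N) x - ∑ j, s j * X j` of the last point `x`. -/
def predCoef (κ N : ℝ) (s : SampleIndex k n ns → ℝ) : SampleIndex k n ns → ℝ :=
  (κ + N) • lastCoef n ns - s

variable {n ns}

lemma sum_expertCoef (i : Fin k) : ∑ j, expertCoef n ns i j = n i + ns := by
  have h : ∀ i', ∑ _j : Fin (n i'), (if i' = i then (1 : ℝ) else 0) =
      if i' = i then (n i : ℝ) else 0 := by
    intro i'
    split_ifs with h
    · simp [h]
    · simp
  simp only [expertCoef, Fintype.sum_sum_type, Fintype.sum_sigma, Sum.elim_inl, Sum.elim_inr, h]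
  simp

lemma sum_sharedCoef : ∑ j, sharedCoef n ns j = ns := by
  simp [sharedCoef]

lemma sum_pooledCoef : ∑ j, pooledCoef n ns j = ((∑ i, n i + ns : ℕ) : ℝ) := by
  simp [pooledCoef]

lemma sum_lastCoef : ∑ j, lastCoef n ns j = 1 := by
  simp [lastCoef]

lemma expertCoef_dotProduct_expertCoef (i j : Fin k) :
    expertCoef n ns i ⬝ᵥ expertCoef n ns j = (if i = j then (n i : ℝ) else 0) + ns := by
  simp only [expertCoef, dotProduct, Fintype.sum_sum_type, Fintype.sum_sigma, Sum.elim_inl,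
    Sum.elim_inr, Finset.sum_const, Finset.card_univ, Fintype.card_fin, nsmul_eq_mul]
  by_cases h : i = j
  · simp [h]
  · simp [h, Ne.symm h]

lemma sharedCoef_dotProduct_expertCoef (i : Fin k) :
    sharedCoef n ns ⬝ᵥ expertCoef n ns i = ns := by
  simp [sharedCoef, expertCoef, dotProduct]

lemma sharedCoef_dotProduct_self : sharedCoef n ns ⬝ᵥ sharedCoef n ns = ns := by
  simp [sharedCoef, dotProduct]

lemma pooledCoef_dotProduct_self :
    pooledCoef n ns ⬝ᵥ pooledCoef n ns = ((∑ i, n i + ns : ℕ) : ℝ) := by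
  simp [pooledCoef, dotProduct]

lemma pooledCoef_dotProduct_expertCoef (i : Fin k) :
    pooledCoef n ns ⬝ᵥ expertCoef n ns i = ∑ j, expertCoef n ns i j := by
  simp [pooledCoef, expertCoef, dotProduct]

lemma pooledCoef_dotProduct_sharedCoef :
    pooledCoef n ns ⬝ᵥ sharedCoef n ns = ∑ j, sharedCoef n ns j := by
  simp [pooledCoef, sharedCoef, dotProduct]

lemma lastCoef_dotProduct_expertCoef (i : Fin k) : lastCoef n ns ⬝ᵥ expertCoef n ns i = 0 := by
  simp [lastCoef, expertCoef, dotProduct]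

lemma lastCoef_dotProduct_sharedCoef : lastCoef n ns ⬝ᵥ sharedCoef n ns = 0 := by
  simp [lastCoef, sharedCoef, dotProduct]

lemma lastCoef_dotProduct_pooledCoef : lastCoef n ns ⬝ᵥ pooledCoef n ns = 0 := by
  simp [lastCoef, pooledCoef, dotProduct]

lemma lastCoef_dotProduct_self : lastCoef n ns ⬝ᵥ lastCoef n ns = 1 := by
  simp [lastCoef, dotProduct]

/-- Adding the experts' sums counts each shared point `k` times instead of once. -/
lemma pooledCoef_eq :
    pooledCoef n ns = ∑ i, expertCoef n ns i - ((k : ℝ) - 1) • sharedCoef n ns := by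
  ext (j | j | j) <;> simp [pooledCoef, expertCoef, sharedCoef]

variable {σ₀ σ : ℝ}

lemma predVar_pos (hσ₀ : 0 < σ₀) (hσ : 0 < σ) (N : ℕ) : 0 < predVar σ₀ σ N := by
  unfold predVar
  positivity

/-- The prediction error is uncorrelated with every statistic of the observed points. -/
lemma linCov_predCoef_left (hσ₀ : σ₀ ≠ 0) {N : ℝ} {s b : SampleIndex k n ns → ℝ}
    (hs : ∑ j, s j = N) (hb : lastCoef n ns ⬝ᵥ b = 0) (hsb : s ⬝ᵥ b = ∑ j, b j) :
    linCov σ₀ σ (predCoef n ns (σ ^ 2 / σ₀ ^ 2) N s) b = 0 := by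
  rw [predCoef, linCov_sub_left, linCov_smul_left]
  simp only [linCov, sum_lastCoef, hs, hb, hsb]
  -- The coefficients of the error add up to `κ`, so the covariance is `(σ₀² κ - σ²) ∑ b`, which
  -- vanishes because `κ = σ²/σ₀²`.
  field_simp
  ring

lemma linCov_predCoef_self (hσ₀ : σ₀ ≠ 0) {N : ℕ} {s : SampleIndex k n ns → ℝ}
    (hs : ∑ j, s j = N) (hss : s ⬝ᵥ s = N) (hls : lastCoef n ns ⬝ᵥ s = 0) :
    linCov σ₀ σ (predCoef n ns (σ ^ 2 / σ₀ ^ 2) N s) (predCoef n ns (σ ^ 2 / σ₀ ^ 2) N s) =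
      predVar σ₀ σ N := by
  simp only [predCoef, linCov_sub_left, linCov_smul_left, linCov_sub_right, linCov_smul_right]
  simp only [linCov, sum_lastCoef, hs, hss, hls, dotProduct_comm s (lastCoef n ns),
    lastCoef_dotProduct_self, predVar]
  field_simp
  ring

lemma sum_predCoef {κ N : ℝ} {s : SampleIndex k n ns → ℝ} (hs : ∑ j, s j = N) :
    ∑ j, predCoef n ns κ N s j = κ := by
  simp only [predCoef, Pi.sub_apply, Pi.smul_apply, smul_eq_mul, Finset.sum_sub_distrib,
    ← Finset.mul_sum, sum_lastCoef, hs]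
  ring

lemma linCov_expertCoef (i j : Fin k) :
    linCov σ₀ σ (expertCoef n ns i) (expertCoef n ns j) = covTT σ₀ σ n ns i j := by
  simp only [linCov, sum_expertCoef, expertCoef_dotProduct_expertCoef, covTT, Matrix.of_apply]
  split_ifs with h
  · subst h
    ring
  · ring

lemma linCov_sharedCoef_expertCoef (i : Fin k) :
    linCov σ₀ σ (sharedCoef n ns) (expertCoef n ns i) = covST σ₀ σ n ns i := by
  simp only [linCov, sum_expertCoef, sum_sharedCoef, sharedCoef_dotProduct_expertCoef, covST]
  ring

lemma linCov_sharedCoef_self :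
    linCov σ₀ σ (sharedCoef n ns) (sharedCoef n ns) = covSS σ₀ σ ns := by
  simp only [linCov, sum_sharedCoef, sharedCoef_dotProduct_self, covSS]
  ring

/-- With `w_i = n_i + n_s`, the matrix is `diag(n_i σ²) + n_s σ² 11' + σ₀² ww'`; the private points
make the diagonal term positive definite. -/
lemma posDef_covTT (hσ : 0 < σ) (hn : ∀ i, 0 < n i) : (covTT σ₀ σ n ns).PosDef := by
  have hd : (Matrix.diagonal fun i => (n i : ℝ) * σ ^ 2).PosDef :=
    Matrix.PosDef.diagonal fun i => by have := hn i; positivity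
  have h1 : (Matrix.vecMulVec (fun _ : Fin k => (1 : ℝ)) (fun _ => 1)).PosSemidef := by
    simpa using! Matrix.posSemidef_vecMulVec_self_star fun _ : Fin k => (1 : ℝ)
  have h2 : (Matrix.vecMulVec (fun i => (n i : ℝ) + ns) fun i => (n i : ℝ) + ns).PosSemidef := by
    simpa using! Matrix.posSemidef_vecMulVec_self_star fun i => (n i : ℝ) + ns
  have h := hd.add_posSemidef ((h1.smul (show 0 ≤ (ns : ℝ) * σ ^ 2 by positivity)).add
    (h2.smul (sq_nonneg σ₀)))
  convert h using 1
  ext i j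
  simp only [covTT, Matrix.of_apply, Matrix.add_apply, Matrix.smul_apply, Matrix.vecMulVec_apply,
    Matrix.diagonal_apply, smul_eq_mul]
  split_ifs with hij
  · subst hij
    ring
  · ring

lemma covTT_transpose : (covTT σ₀ σ n ns)ᵀ = covTT σ₀ σ n ns := by
  ext i j
  rw [Matrix.transpose_apply, ← linCov_expertCoef, ← linCov_expertCoef, linCov_comm]

/-- The coefficients `V₂₂⁻¹ V₂₁` of the regression of `t_s` on the experts' sums. -/
noncomputable def regCoef (σ₀ σ : ℝ) (n : Fin k → ℕ) (ns : ℕ) : Fin k → ℝ :=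
  (covTT σ₀ σ n ns)⁻¹ *ᵥ covST σ₀ σ n ns

/-- Coefficients of the residual of the regression of `t_s` on the experts' sums. -/
noncomputable def residCoef (σ₀ σ : ℝ) (n : Fin k → ℕ) (ns : ℕ) : SampleIndex k n ns → ℝ :=
  sharedCoef n ns - ∑ i, regCoef σ₀ σ n ns i • expertCoef n ns i

/-- These are the normal equations `V₂₂ β = V₂₁` of the regression. -/
lemma linCov_residCoef_expertCoef (hσ : 0 < σ) (hn : ∀ i, 0 < n i) (j : Fin k) :
    linCov σ₀ σ (residCoef σ₀ σ n ns) (expertCoef n ns j) = 0 := by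
  have hdet : IsUnit (covTT σ₀ σ n ns).det :=
    (Matrix.isUnit_iff_isUnit_det _).1 (posDef_covTT hσ hn).isUnit
  have h : covTT σ₀ σ n ns *ᵥ regCoef σ₀ σ n ns = covST σ₀ σ n ns := by
    rw [regCoef, Matrix.mulVec_mulVec, Matrix.mul_nonsing_inv _ hdet, Matrix.one_mulVec]
  rw [residCoef, linCov_sub_left, linCov_sum_left, linCov_sharedCoef_expertCoef, ← h, sub_eq_zero,
    Matrix.mulVec, dotProduct]
  refine Finset.sum_congr rfl fun i _ => ?_
  rw [linCov_smul_left, ← linCov_expertCoef, linCov_comm (expertCoef n ns j), mul_comm]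

/-- The residual is orthogonal to the regressors, so its variance equals its covariance with `t_s`.
-/
lemma linCov_residCoef_self (hσ : 0 < σ) (hn : ∀ i, 0 < n i) :
    linCov σ₀ σ (residCoef σ₀ σ n ns) (residCoef σ₀ σ n ns) = sharedVar σ₀ σ n ns := by
  have h : ∀ d, linCov σ₀ σ d (residCoef σ₀ σ n ns) = linCov σ₀ σ d (sharedCoef n ns) -
      ∑ i, regCoef σ₀ σ n ns i * linCov σ₀ σ d (expertCoef n ns i) := fun d => by
    simp_rw [residCoef, linCov_sub_right, linCov_sum_right, linCov_smul_right]
  rw [h]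
  simp_rw [linCov_residCoef_expertCoef hσ hn, mul_zero, Finset.sum_const_zero, sub_zero]
  rw [linCov_comm, h, linCov_sharedCoef_self, sharedVar]
  simp_rw [linCov_sharedCoef_expertCoef]
  rw [dotProduct_comm]
  rfl

lemma sharedMean_eq (θ₀ : ℝ) (u : Fin k → ℝ) :
    sharedMean θ₀ σ₀ σ n ns u = ns * θ₀ + ∑ i, regCoef σ₀ σ n ns i *
      (√(predVar σ₀ σ (n i + ns)) * u i - priorTau θ₀ σ₀ σ - (n i + ns) * θ₀) := by
  rw [sharedMean, Matrix.dotProduct_mulVec, ← Matrix.mulVec_transpose,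
    Matrix.transpose_nonsing_inv, covTT_transpose]
  rfl

lemma sum_residCoef :
    ∑ j, residCoef σ₀ σ n ns j = ns - ∑ i, regCoef σ₀ σ n ns i * (n i + ns) := by
  simp only [residCoef, Pi.sub_apply, Finset.sum_sub_distrib, sum_sharedCoef, Finset.sum_apply,
    Pi.smul_apply, smul_eq_mul]
  rw [Finset.sum_comm]
  simp_rw [← Finset.mul_sum, sum_expertCoef]

end

/-! ### Values of the statistics on the data. -/

section

variable {Ω : Type*} {k : ℕ} {n : Fin k → ℕ} {ns : ℕ} (X : SampleIndex k n ns → Ω → ℝ)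

lemma linStat_expertCoef (i : Fin k) (ω : Ω) :
    linStat X (expertCoef n ns i) ω =
      ∑ j, X (Sum.inl ⟨i, j⟩) ω + ∑ j, X (Sum.inr (Sum.inl j)) ω := by
  simp only [linStat, expertCoef, Fintype.sum_sum_type, Sum.elim_inl, Sum.elim_inr,
    Fintype.sum_sigma, ite_mul, one_mul, zero_mul, Finset.sum_const_zero, add_zero]
  congr 1
  rw [Finset.sum_eq_single i]
  · simp
  · intro b _ hb
    simp [hb]
  · simp

lemma linStat_sharedCoef : linStat X (sharedCoef n ns) = sharedStat X := by
  funext ω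
  simp [linStat, sharedCoef, sharedStat]

lemma linStat_lastCoef (ω : Ω) :
    linStat X (lastCoef n ns) ω = X (Sum.inr (Sum.inr ())) ω := by
  simp [linStat, lastCoef]

lemma linStat_predCoef (κ N : ℝ) (s : SampleIndex k n ns → ℝ) (ω : Ω) :
    linStat X (predCoef n ns κ N s) ω =
      (κ + N) * X (Sum.inr (Sum.inr ())) ω - linStat X s ω := by
  rw [predCoef, linStat_sub, linStat_smul, linStat_lastCoef]

lemma linStat_residCoef {σ₀ σ : ℝ} (ω : Ω) :
    linStat X (residCoef σ₀ σ n ns) ω = sharedStat X ω -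
      ∑ i, regCoef σ₀ σ n ns i * linStat X (expertCoef n ns i) ω := by
  rw [residCoef, linStat_sub, linStat_sharedCoef, linStat_sum]
  simp_rw [linStat_smul]

end

/-! ### Conditional laws given an expert's data and given the reports. -/

section

variable {Ω : Type*} {mΩ : MeasurableSpace Ω} {μ : Measure Ω} [IsProbabilityMeasure μ] {k : ℕ}
  {n : Fin k → ℕ} {ns : ℕ} {θ₀ σ₀ σ : ℝ} {X : SampleIndex k n ns → Ω → ℝ}

omit mΩ in
lemma indep_comap_sub_const {m₀ : MeasurableSpace Ω} {ν : Measure[m₀] Ω} {m : MeasurableSpace Ω}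
    {R : Ω → ℝ} (h : Indep (MeasurableSpace.comap R inferInstance) m ν) (c : ℝ) :
    Indep (MeasurableSpace.comap (fun ω => R ω - c) inferInstance) m ν :=
  indep_of_indep_of_le_left h
    ((measurable_id.sub_const c).comp (comap_measurable R)).comap_le

namespace IsEquicorrelatedNormal

variable (hX : IsEquicorrelatedNormal μ θ₀ σ₀ σ X)
include hX

omit [IsProbabilityMeasure μ] in
lemma measurableSet_event : MeasurableSet (event X) := hX.measurable _ measurableSet_Ioi

/-- The predictive probability of the event given `N` observed points. -/
lemma condExp_event (hσ₀ : 0 < σ₀) (hσ : 0 < σ) {m : MeasurableSpace Ω}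
    (hm : m ≤ mΩ) {N : ℕ} {s : SampleIndex k n ns → ℝ}
    (hs : ∑ j, s j = N) (hss : s ⬝ᵥ s = N) (hls : lastCoef n ns ⬝ᵥ s = 0)
    (hsm : Measurable[m] (linStat X s))
    (hind : Indep (MeasurableSpace.comap
      (linStat X (predCoef n ns (σ ^ 2 / σ₀ ^ 2) N s)) inferInstance) m μ) :
    μ⟦event X | m⟧ =ᵐ[μ] fun ω =>
      stdNormalCDF ((priorTau θ₀ σ₀ σ + linStat X s ω) / √(predVar σ₀ σ N)) := by
  refine condExp_indicator_pos hm
    (M := fun ω => priorTau θ₀ σ₀ σ + linStat X s ω)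
    (R := fun ω => linStat X (predCoef n ns (σ ^ 2 / σ₀ ^ 2) N s) ω - priorTau θ₀ σ₀ σ)
    (predVar_pos hσ₀ hσ N) (hsm.const_add _)
    ((hX.measurable_linStat _).sub_const _) ?_ (indep_comap_sub_const hind _)
    hX.measurableSet_event ?_
  · refine hX.map_linStat_sub _ ?_ (linCov_predCoef_self hσ₀.ne' hs hss hls)
    rw [sum_predCoef hs, priorTau]
    ring
  · refine .of_forall fun ω => propext ?_
    have hc : 0 < σ ^ 2 / σ₀ ^ 2 + N := by positivity
    change 0 < X (Sum.inr (Sum.inr ())) ω ↔ 0 < _ + _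
    -- Multiplied by `κ + N > 0`, the last point is exactly signal plus noise.
    rw [linStat_predCoef, ← mul_pos_iff_of_pos_left hc]
    refine iff_of_eq (congrArg _ ?_)
    ring

/-- This is the predictive probability with no observed points, given the trivial sigma-algebra. -/
lemma measureReal_event (hσ₀ : 0 < σ₀) (hσ : 0 < σ) :
    μ.real (event X) = stdNormalCDF (priorTau θ₀ σ₀ σ / √(predVar σ₀ σ 0)) := by
  have h0 : linStat X 0 = fun _ => 0 := by
    funext ω
    simp [linStat]
  have h := hX.condExp_event hσ₀ hσ (m := ⊥) bot_le (N := 0) (s := 0) (by simp) (by simp)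
    (by simp) (by rw [h0]; exact measurable_const) (indep_bot_right _)
  rw [condExp_bot, integral_indicator_const _ hX.measurableSet_event, h0] at h
  -- Both sides are constant, so the almost sure identity can be read off at any one point where it
  -- holds.
  obtain ⟨ω, hω⟩ := h.exists
  simpa using hω

omit [IsProbabilityMeasure μ] in
lemma expertInfo_le (i : Fin k) : expertInfo X i ≤ mΩ := by
  refine Measurable.comap_le ?_
  exact (measurable_pi_lambda _ fun _ => hX.measurable _).prodMk
    (measurable_pi_lambda _ fun _ => hX.measurable _)

/-- The probability that expert `i` reports. -/
lemma condExp_event_expertInfo (hσ₀ : 0 < σ₀) (hσ : 0 < σ) (i : Fin k) :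
    μ⟦event X | expertInfo X i⟧ =ᵐ[μ] fun ω =>
      stdNormalCDF ((priorTau θ₀ σ₀ σ + linStat X (expertCoef n ns i) ω) /
        √(predVar σ₀ σ (n i + ns))) := by
  have hsum : ∑ j, expertCoef n ns i j = ((n i + ns : ℕ) : ℝ) := by
    rw [sum_expertCoef]
    push_cast
    rfl
  refine hX.condExp_event hσ₀ hσ (hX.expertInfo_le i) hsum ?_ (lastCoef_dotProduct_expertCoef i)
    ?_ ?_
  · rw [expertCoef_dotProduct_expertCoef]
    simp
  · have hf : Measurable fun q : (Fin (n i) → ℝ) × (Fin ns → ℝ) => ∑ j, q.1 j + ∑ j, q.2 j := by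
      fun_prop
    have := hf.comp (comap_measurable fun ω => ((fun j : Fin (n i) => X (Sum.inl ⟨i, j⟩) ω),
      (fun j : Fin ns => X (Sum.inr (Sum.inl j)) ω)))
    convert this using 1
    funext ω
    exact linStat_expertCoef X i ω
  -- The expert sees the individual points, so the error must be independent of all of them jointly
  -- and not merely of their sum.
  · have hsingle : ∀ j, linStat X (Pi.single j 1) = X j := fun j => by
      funext ω
      simp [linStat, Pi.single_apply]
    have hI := hX.indepFun_linStat
      (predCoef n ns (σ ^ 2 / σ₀ ^ 2) ((n i + ns : ℕ) : ℝ) (expertCoef n ns i))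
      (Sum.elim (fun j : Fin (n i) => Pi.single (Sum.inl ⟨i, j⟩) 1)
        (fun j : Fin ns => Pi.single (Sum.inr (Sum.inl j)) 1)) fun l =>
      linCov_predCoef_left hσ₀.ne' hsum (by rcases l with l | l <;> simp [lastCoef])
        (by rcases l with l | l <;> simp [expertCoef])
    have hg : Measurable fun z : Fin (n i) ⊕ Fin ns → ℝ =>
        ((fun j => z (Sum.inl j)), fun j => z (Sum.inr j)) := by fun_prop
    have hI' := hI.comp measurable_id hg
    simp only [Function.comp_def, Sum.elim_inl, Sum.elim_inr, hsingle] at hI'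
    exact hI'

variable {p : Fin k → Ω → ℝ}

lemma report_ae_eq (hσ₀ : 0 < σ₀) (hσ : 0 < σ)
    (hp : ∀ i, IsCondProb μ (expertInfo X i) (event X) (p i)) :
    ∀ᵐ ω ∂μ, ∀ i, p i ω = stdNormalCDF
      ((priorTau θ₀ σ₀ σ + linStat X (expertCoef n ns i) ω) / √(predVar σ₀ σ (n i + ns))) :=
  ae_all_iff.2 fun i => (hp i).2.trans (hX.condExp_event_expertInfo hσ₀ hσ i)

lemma probit_report_ae_eq (hσ₀ : 0 < σ₀) (hσ : 0 < σ)
    (hp : ∀ i, IsCondProb μ (expertInfo X i) (event X) (p i)) :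
    ∀ᵐ ω ∂μ, ∀ i, √(predVar σ₀ σ (n i + ns)) * probit (p i ω) =
      priorTau θ₀ σ₀ σ + linStat X (expertCoef n ns i) ω := by
  filter_upwards [hX.report_ae_eq hσ₀ hσ hp] with ω hω i
  rw [hω i, probit_stdNormalCDF]
  exact mul_div_cancel₀ _ (Real.sqrt_pos.2 (predVar_pos hσ₀ hσ _)).ne'

omit [IsProbabilityMeasure μ] in
lemma reportInfo_le (hp : ∀ i, IsCondProb μ (expertInfo X i) (event X) (p i)) :
    reportInfo p ≤ mΩ :=
  Measurable.comap_le (measurable_pi_lambda _ fun i => (hp i).1.mono (hX.expertInfo_le i) le_rfl)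

/-- A statistic that is uncorrelated with the experts' sums is independent of the reports. -/
lemma indep_reportInfo (hσ₀ : 0 < σ₀) (hσ : 0 < σ)
    (hp : ∀ i, IsCondProb μ (expertInfo X i) (event X) (p i)) {r : SampleIndex k n ns → ℝ}
    (hr : ∀ i, linCov σ₀ σ r (expertCoef n ns i) = 0) :
    Indep (MeasurableSpace.comap (linStat X r) inferInstance) (reportInfo p) μ := by
  have hg : Measurable fun (t : Fin k → ℝ) i => stdNormalCDF
      ((priorTau θ₀ σ₀ σ + t i) / √(predVar σ₀ σ (n i + ns))) :=
    measurable_pi_lambda _ fun i => continuous_stdNormalCDF.measurable.comp (by fun_prop)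
  have h := (hX.indepFun_linStat r (expertCoef n ns) hr).comp measurable_id hg
  have h' : IndepFun (linStat X r) (fun ω i => p i ω) μ := by
    -- The reports are only almost surely functions of the experts' sums; independence survives a
    -- change on a null set.
    refine h.congr ae_eq_rfl ?_
    filter_upwards [hX.report_ae_eq hσ₀ hσ hp] with ω hω
    exact funext fun i => (hω i).symm
  exact h'

/-- Regression of `t_s` on the reports. -/
lemma sharedStat_ae_eq (hσ₀ : 0 < σ₀) (hσ : 0 < σ)
    (hp : ∀ i, IsCondProb μ (expertInfo X i) (event X) (p i)) :
    ∀ᵐ ω ∂μ, sharedStat X ω = sharedMean θ₀ σ₀ σ n ns (fun i => probit (p i ω)) +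
      (linStat X (residCoef σ₀ σ n ns) ω - (∑ j, residCoef σ₀ σ n ns j) * θ₀) := by
  filter_upwards [hX.probit_report_ae_eq hσ₀ hσ hp] with ω hω
  rw [sharedMean_eq, linStat_residCoef, sum_residCoef]
  simp_rw [hω]
  have : ∀ i, regCoef σ₀ σ n ns i * (priorTau θ₀ σ₀ σ + linStat X (expertCoef n ns i) ω -
      priorTau θ₀ σ₀ σ - (n i + ns) * θ₀) = regCoef σ₀ σ n ns i * linStat X (expertCoef n ns i) ω -
      regCoef σ₀ σ n ns i * (n i + ns) * θ₀ := fun i => by ring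
  simp_rw [this, Finset.sum_sub_distrib, ← Finset.sum_mul]
  ring

omit mΩ hX in
lemma measurable_sharedMean_probit :
    Measurable[reportInfo p] fun ω => sharedMean θ₀ σ₀ σ n ns (fun i => probit (p i ω)) := by
  have hg : Measurable fun q : Fin k → ℝ => sharedMean θ₀ σ₀ σ n ns (fun i => probit (q i)) := by
    simp_rw [sharedMean_eq]
    have : ∀ i : Fin k, Measurable fun q : Fin k → ℝ => probit (q i) := fun i =>
      measurable_probit.comp (measurable_pi_apply i)
    fun_prop
  exact hg.comp (comap_measurable _)

omit [IsProbabilityMeasure μ] in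
lemma memLp_sharedStat : MemLp (sharedStat X) 2 μ := by
  rw [← linStat_sharedCoef]
  exact (hX.hasGaussianLaw_linStat _).memLp_two

lemma condExp_sharedStat (hσ₀ : 0 < σ₀) (hσ : 0 < σ) (hn : ∀ i, 0 < n i)
    (hp : ∀ i, IsCondProb μ (expertInfo X i) (event X) (p i)) :
    μ[sharedStat X | reportInfo p] =ᵐ[μ] fun ω =>
      sharedMean θ₀ σ₀ σ n ns (fun i => probit (p i ω)) := by
  have hm := hX.reportInfo_le hp
  set c := (∑ j, residCoef σ₀ σ n ns j) * θ₀ with hc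
  set D : Ω → ℝ := fun ω => linStat X (residCoef σ₀ σ n ns) ω - c with hD
  set S : Ω → ℝ := fun ω => sharedMean θ₀ σ₀ σ n ns (fun i => probit (p i ω)) with hS
  have hSm : Measurable[reportInfo p] S := measurable_sharedMean_probit
  have hDi : Integrable D μ :=
    (hX.hasGaussianLaw_linStat _).integrable.sub (integrable_const c)
  have hts : sharedStat X =ᵐ[μ] S + D := hX.sharedStat_ae_eq hσ₀ hσ hp
  have hSi : Integrable S μ := by
    refine ((hX.memLp_sharedStat.integrable one_le_two).sub hDi).congr ?_
    filter_upwards [hts] with ω hω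
    simp [hω]
  have hD0 : μ[D] = 0 := by
    change ∫ ω, (linStat X (residCoef σ₀ σ n ns) ω - c) ∂μ = 0
    rw [integral_sub (hX.hasGaussianLaw_linStat _).integrable (integrable_const c),
      hX.integral_linStat]
    simp [hc]
  have hDm : Measurable D := (hX.measurable_linStat _).sub_const c
  have hDc : μ[D | reportInfo p] =ᵐ[μ] fun _ => 0 := by
    have := condExp_indep_eq hDm.comap_le hm (comap_measurable D).stronglyMeasurable
      (indep_comap_sub_const
        (hX.indep_reportInfo hσ₀ hσ hp (linCov_residCoef_expertCoef hσ hn)) c)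
    rwa [hD0] at this
  filter_upwards [condExp_congr_ae (m := reportInfo p) hts, condExp_add hSi hDi (reportInfo p), hDc]
    with ω h1 h2 h3
  rw [h1, h2, Pi.add_apply, h3, add_zero,
    condExp_of_stronglyMeasurable hm hSm.stronglyMeasurable hSi]

/-- The deviation of `t_s` from its conditional mean is almost surely the centred residual, whose
square is independent of the reports; conditioning therefore returns its plain expectation. -/
lemma condVar_sharedStat (hσ₀ : 0 < σ₀) (hσ : 0 < σ) (hn : ∀ i, 0 < n i)
    (hp : ∀ i, IsCondProb μ (expertInfo X i) (event X) (p i)) :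
    Var[sharedStat X; μ | reportInfo p] =ᵐ[μ] fun _ => sharedVar σ₀ σ n ns := by
  have hm := hX.reportInfo_le hp
  set c := (∑ j, residCoef σ₀ σ n ns j) * θ₀ with hc
  set D : Ω → ℝ := fun ω => linStat X (residCoef σ₀ σ n ns) ω - c with hD
  have hDm : Measurable D := (hX.measurable_linStat _).sub_const c
  have hlaw : μ.map D = gaussianReal 0 (sharedVar σ₀ σ n ns).toNNReal :=
    hX.map_linStat_sub _ hc.symm (linCov_residCoef_self hσ hn)
  have hD2 : ∫ ω, (D ^ 2) ω ∂μ = sharedVar σ₀ σ n ns := by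
    have hG := hX.hasGaussianLaw_linStat (residCoef σ₀ σ n ns)
    have h1 : Var[linStat X (residCoef σ₀ σ n ns); μ] = sharedVar σ₀ σ n ns := by
      rw [← covariance_self hG.aemeasurable, hX.covariance_linStat, linCov_residCoef_self hσ hn]
    rw [variance_eq_integral hG.aemeasurable, hX.integral_linStat] at h1
    exact h1
  have hcD : (sharedStat X - μ[sharedStat X | reportInfo p]) ^ 2 =ᵐ[μ] D ^ 2 := by
    filter_upwards [hX.sharedStat_ae_eq hσ₀ hσ hp, hX.condExp_sharedStat hσ₀ hσ hn hp]
      with ω h1 h2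
    simp only [Pi.pow_apply, Pi.sub_apply, h2]
    rw [h1, add_sub_cancel_left]
  have hD2m : Measurable[MeasurableSpace.comap D inferInstance] (D ^ 2) :=
    (comap_measurable D).pow_const 2
  have := condExp_indep_eq hDm.comap_le hm hD2m.stronglyMeasurable
      (indep_comap_sub_const
        (hX.indep_reportInfo hσ₀ hσ hp (linCov_residCoef_expertCoef hσ hn)) c)
  rw [hD2] at this
  exact (condExp_congr_ae hcD).trans this

lemma condExp_event_reportInfo (hσ₀ : 0 < σ₀) (hσ : 0 < σ) (hn : ∀ i, 0 < n i)
    (hp : ∀ i, IsCondProb μ (expertInfo X i) (event X) (p i)) :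
    μ⟦event X | reportInfo p⟧ =ᵐ[μ] fun ω => stdNormalCDF
      ((-((k : ℝ) - 1) * priorTau θ₀ σ₀ σ + ∑ i, √(predVar σ₀ σ (n i + ns)) * probit (p i ω)
        - ((k : ℝ) - 1) * sharedMean θ₀ σ₀ σ n ns (fun i => probit (p i ω))) /
      √(((k : ℝ) - 1) ^ 2 * sharedVar σ₀ σ n ns + predVar σ₀ σ ((∑ i, n i) + ns))) := by
  have hm := hX.reportInfo_le hp
  set N := (∑ i, n i) + ns with hN
  have hvar : 0 ≤ sharedVar σ₀ σ n ns := by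
    rw [← linCov_residCoef_self hσ hn, linCov]
    exact add_nonneg (mul_nonneg (sq_nonneg _) (mul_self_nonneg _))
      (mul_nonneg (sq_nonneg _) (Finset.sum_nonneg fun _ _ => mul_self_nonneg _))
  have hv : 0 < ((k : ℝ) - 1) ^ 2 * sharedVar σ₀ σ n ns + predVar σ₀ σ N :=
    add_pos_of_nonneg_of_pos (mul_nonneg (sq_nonneg _) hvar) (predVar_pos hσ₀ hσ N)
  set e := predCoef n ns (σ ^ 2 / σ₀ ^ 2) N (pooledCoef n ns) with he
  set q := residCoef σ₀ σ n ns with hq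
  have hsum : ∑ j, pooledCoef n ns j = (N : ℝ) := sum_pooledCoef
  have heT : ∀ i, linCov σ₀ σ e (expertCoef n ns i) = 0 := fun i =>
    linCov_predCoef_left hσ₀.ne' hsum (lastCoef_dotProduct_expertCoef i)
      (pooledCoef_dotProduct_expertCoef i)
  have heS : linCov σ₀ σ e (sharedCoef n ns) = 0 :=
    linCov_predCoef_left hσ₀.ne' hsum lastCoef_dotProduct_sharedCoef
      pooledCoef_dotProduct_sharedCoef
  have hqT : ∀ i, linCov σ₀ σ q (expertCoef n ns i) = 0 := linCov_residCoef_expertCoef hσ hn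
  have heq : linCov σ₀ σ e q = 0 := by
    rw [hq, residCoef, linCov_sub_right, linCov_sum_right]
    simp [linCov_smul_right, heT, heS]
  -- The part of `(κ + N) x` that the reports do not determine: the pooled prediction error, and the
  -- residual of `t_s`, which enters the pooled sum with weight `-(k-1)`.
  set r := e - ((k : ℝ) - 1) • q with hr
  have hrT : ∀ i, linCov σ₀ σ r (expertCoef n ns i) = 0 := fun i => by
    rw [hr, linCov_sub_left, linCov_smul_left, heT, hqT]
    ring
  have hrr : linCov σ₀ σ r r = ((k : ℝ) - 1) ^ 2 * sharedVar σ₀ σ n ns + predVar σ₀ σ N := by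
    have hee : linCov σ₀ σ e e = predVar σ₀ σ N :=
      linCov_predCoef_self hσ₀.ne' hsum pooledCoef_dotProduct_self lastCoef_dotProduct_pooledCoef
    simp only [hr, linCov_sub_left, linCov_smul_left, linCov_sub_right, linCov_smul_right,
      linCov_comm q e, heq, hee]
    rw [linCov_residCoef_self hσ hn]
    ring
  have hmean : (∑ j, r j) * θ₀ = priorTau θ₀ σ₀ σ - ((k : ℝ) - 1) * ((∑ j, q j) * θ₀) := by
    simp only [hr, Pi.sub_apply, Pi.smul_apply, smul_eq_mul, Finset.sum_sub_distrib,
      ← Finset.mul_sum]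
    rw [he, sum_predCoef hsum, priorTau]
    ring
  have hprob : Measurable[reportInfo p] fun ω =>
      ∑ i, √(predVar σ₀ σ (n i + ns)) * probit (p i ω) := by
    have hg : Measurable fun t : Fin k → ℝ =>
        ∑ i, √(predVar σ₀ σ (n i + ns)) * probit (t i) :=
      Finset.measurable_sum _ fun i _ =>
        (measurable_probit.comp (measurable_pi_apply i)).const_mul _
    exact hg.comp (comap_measurable fun ω i => p i ω)
  refine condExp_indicator_pos hm hv
    ((hprob.const_add _).sub (measurable_sharedMean_probit.const_mul _))
    ((hX.measurable_linStat r).sub_const _) (hX.map_linStat_sub r hmean hrr)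
    (indep_comap_sub_const (hX.indep_reportInfo hσ₀ hσ hp hrT) _) hX.measurableSet_event ?_
  filter_upwards [hX.probit_report_ae_eq hσ₀ hσ hp, hX.sharedStat_ae_eq hσ₀ hσ hp] with ω h1 h2
  refine propext ?_
  have hc : 0 < σ ^ 2 / σ₀ ^ 2 + (N : ℝ) := by positivity
  change 0 < X (Sum.inr (Sum.inr ())) ω ↔ 0 < _ + _
  have hpool : linStat X (pooledCoef n ns) ω =
      ∑ i, linStat X (expertCoef n ns i) ω - ((k : ℝ) - 1) * sharedStat X ω := by
    rw [pooledCoef_eq, linStat_sub, linStat_sum, linStat_smul, linStat_sharedCoef]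
  rw [← mul_pos_iff_of_pos_left hc]
  refine iff_of_eq (congrArg _ ?_)
  simp only [Pi.sub_apply, h1, Finset.sum_add_distrib]
  rw [hr, linStat_sub, linStat_smul, he, linStat_predCoef, hpool]
  -- The `k` probit terms contribute `k τ₁`; with `-(k-1) τ₁` a single `τ₁` remains, which cancels
  -- the centring of `e`.
  simp only [Finset.sum_const, Finset.card_univ, Fintype.card_fin, nsmul_eq_mul]
  linear_combination (-((k : ℝ) - 1)) * h2

end IsEquicorrelatedNormal

end

end NormalEnsemble

/-! ### Assembly of the theorem. -/

open NormalEnsemble in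
theorem proposition3 {Ω : Type*} [MeasurableSpace Ω] (μ : Measure Ω) [IsProbabilityMeasure μ]
    (k : ℕ) (hk : 2 ≤ k) (n : Fin k → ℕ) (hn : ∀ i, 0 < n i) (ns : ℕ) (hns : 0 < ns)
    (θ₀ σ₀ σ : ℝ) (hσ₀ : 0 < σ₀) (hσ : 0 < σ)
    (θ : Ω → ℝ) (X : SampleIndex k n ns → Ω → ℝ)
    (hX : IsNormalNormalPair μ θ₀ σ₀ σ θ X)
    (p₀ : ℝ) (hp₀ : p₀ = μ.real (event X))
    (p : Fin k → Ω → ℝ) (hp : ∀ i, IsCondProb μ (expertInfo X i) (event X) (p i)) :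
    -- the quantities in the formula are well defined
    (p₀ ∈ Set.Ioo (0 : ℝ) 1 ∧ (∀ᵐ ω ∂μ, ∀ i, p i ω ∈ Set.Ioo (0 : ℝ) 1) ∧
      (∀ x ∈ Set.Ioo (0 : ℝ) 1, stdNormalCDF (probit x) = x) ∧
      MemLp (sharedStat X) 2 μ ∧ IsUnit (covTT σ₀ σ n ns).det) ∧
    -- the Bayesian ensemble
    (μ⟦event X | reportInfo p⟧ =ᵐ[μ] fun ω =>
      stdNormalCDF
        ((-((k : ℝ) - 1) * √(predVar σ₀ σ 0) * probit p₀
            + ∑ i, √(predVar σ₀ σ (n i + ns)) * probit (p i ω)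
            - ((k : ℝ) - 1) * (μ[sharedStat X | reportInfo p]) ω)
          / √(((k : ℝ) - 1) ^ 2 * (Var[sharedStat X; μ | reportInfo p]) ω
            + predVar σ₀ σ ((∑ i, n i) + ns)))) ∧
    -- the conditional mean is linear in the probits of the reports, with explicit coefficients
    (μ[sharedStat X | reportInfo p] =ᵐ[μ] fun ω =>
      sharedMean θ₀ σ₀ σ n ns (fun i => probit (p i ω))) ∧
    (∃ (a : ℝ) (b : Fin k → ℝ), ∀ u : Fin k → ℝ,
      sharedMean θ₀ σ₀ σ n ns u = a + ∑ i, b i * u i) ∧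
    -- the conditional variance does not depend on the reports
    (Var[sharedStat X; μ | reportInfo p] =ᵐ[μ] fun _ => sharedVar σ₀ σ n ns) := by

  have hN := hX.isEquicorrelatedNormal
  have hp0 := hN.measureReal_event hσ₀ hσ
  rw [← hp₀] at hp0
  -- The prior probability enters the ensemble formula only through `τ₁`.
  have hτ : √(predVar σ₀ σ 0) * probit p₀ = priorTau θ₀ σ₀ σ := by
    rw [hp0, probit_stdNormalCDF]
    exact mul_div_cancel₀ _ (Real.sqrt_pos.2 (predVar_pos hσ₀ hσ 0)).ne'
  have hE := hN.condExp_sharedStat hσ₀ hσ hn hp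
  have hV := hN.condVar_sharedStat hσ₀ hσ hn hp
  refine ⟨⟨?_, ?_, fun x hx => stdNormalCDF_probit hx, hN.memLp_sharedStat,
    (Matrix.isUnit_iff_isUnit_det _).1 (posDef_covTT hσ hn).isUnit⟩, ?_, hE, ?_, hV⟩
  · rw [hp0]
    exact stdNormalCDF_mem_Ioo _
  · filter_upwards [hN.report_ae_eq hσ₀ hσ hp] with ω hω i
    rw [hω i]
    exact stdNormalCDF_mem_Ioo _
  · filter_upwards [hN.condExp_event_reportInfo hσ₀ hσ hn hp, hE, hV] with ω h1 h2 h3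
    rw [h1, h2, h3, mul_assoc, hτ]
  · refine ⟨ns * θ₀ - ∑ i, regCoef σ₀ σ n ns i * (priorTau θ₀ σ₀ σ + (n i + ns) * θ₀),
      fun i => regCoef σ₀ σ n ns i * √(predVar σ₀ σ (n i + ns)), fun u => ?_⟩
    rw [sharedMean_eq, sub_add, ← Finset.sum_sub_distrib, sub_eq_add_neg, ← Finset.sum_neg_distrib]
    congr 1
    exact Finset.sum_congr rfl fun i _ => by ring
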